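/- Theorem. Let $(M^*, g^*)$ be a smooth Riemannian manifold of dimension $n-1$ with $n>3$, let $J\subseteq\mathbb R$ be an open interval and let $a: J\to(0,\infty)$ be smooth and not constant. Consider the generalized Robertson-Walker (GRW) space-time $-J\times_a M^*$, that is, the $n$-dimensional Lorentzian manifold $J\times M^*$ with the metric $g=-dt^2+a(t)^2 g^*$, with Levi-Civita connection $\nabla$, Ricci tensor $\mathrm R_{kl}$ and scalar curvature $\mathrm R$. If the Ricci tensor is a Killing tensor (Gray's subspace $\mathcal A$), that is, if $$\nabla_j \mathrm R_{kl}+\nabla_k \mathrm R_{lj}+\nabla_l \mathrm R_{jk}=0 ,$$ then it is parallel, $\nabla_j \mathrm R_{kl}=0$, and the metric is Einstein, $\mathrm R_{kl}=\frac{\mathrm R}{n}\, g_{kl}$. In particular, on these space-times the Ricci tensor is Killing if and only if it is parallel: the subspace $\mathcal A$ adds nothing to the trivial subspace $\nabla_j\mathrm R_{kl}=0$. -/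

import Mathlib

open scoped Manifold ContDiff

set_option maxSynthPendingDepth 5

noncomputable section

namespace SemiRiem

section Coordinates

/-! ### Curvature of a (semi-Riemannian) metric in coordinates

`E` is the coordinate space and `G x` is the matrix `g_{ij}(x)` of the metric at the coordinate
point `x`, seen as a bilinear form on `E`. Vectors `u v w z : E` are constant coordinate vector
fields. Every tensor is written without indices: its value on coordinate vectors. -/

variable {E : Type*} [NormedAddCommGroup E] [NormedSpace ℝ E]

/-- Christoffel symbols of the first kind,
`[v, w; z] = ½ (∂_v g(w, z) + ∂_w g(v, z) - ∂_z g(v, w))`. -/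
def christoffelFirst (G : E → E →L[ℝ] E →L[ℝ] ℝ) (x : E) : E →L[ℝ] E →L[ℝ] E →L[ℝ] ℝ :=
  let D : E →L[ℝ] E →L[ℝ] E →L[ℝ] ℝ := fderiv ℝ G x
  let F : (E →L[ℝ] E →L[ℝ] ℝ) →L[ℝ] (E →L[ℝ] E →L[ℝ] ℝ) :=
    (ContinuousLinearMap.flipₗᵢ ℝ E E ℝ).toContinuousLinearEquiv.toContinuousLinearMap
  (1 / 2 : ℝ) • (D + D.flip - F.comp D.flip)

theorem christoffelFirst_apply (G : E → E →L[ℝ] E →L[ℝ] ℝ) (x v w z : E) :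
    christoffelFirst G x v w z =
      1 / 2 * (fderiv ℝ G x v w z + fderiv ℝ G x w v z - fderiv ℝ G x z v w) := by
  simp [christoffelFirst]

/-- Christoffel symbols `Γ(v, w)` of the Levi-Civita connection (that is, `∇_v w` for the
coordinate fields `v`, `w`): the index of `christoffelFirst` is raised with the inverse metric. -/
def christoffel (G : E → E →L[ℝ] E →L[ℝ] ℝ) (x : E) : E →L[ℝ] E →L[ℝ] E :=
  (ContinuousLinearMap.compL ℝ E (E →L[ℝ] ℝ) E (G x).inverse).comp (christoffelFirst G x)

theorem christoffel_apply (G : E → E →L[ℝ] E →L[ℝ] ℝ) (x v w : E) :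
    christoffel G x v w = (G x).inverse (christoffelFirst G x v w) := rfl

/-- The curvature tensor,
`R(u, v) w = ∂_u Γ(v, w) - ∂_v Γ(u, w) + Γ(u, Γ(v, w)) - Γ(v, Γ(u, w))`. -/
def riemann (G : E → E →L[ℝ] E →L[ℝ] ℝ) (x : E) : E →L[ℝ] E →L[ℝ] E →L[ℝ] E :=
  let D := fderiv ℝ (christoffel G) x
  let Q := (ContinuousLinearMap.compL ℝ E E E).bilinearComp (christoffel G x) (christoffel G x)
  D - D.flip + Q - Q.flip

theorem riemann_apply (G : E → E →L[ℝ] E →L[ℝ] ℝ) (x u v w : E) :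
    riemann G x u v w =
      fderiv ℝ (christoffel G) x u v w - fderiv ℝ (christoffel G) x v u w
        + christoffel G x u (christoffel G x v w) - christoffel G x v (christoffel G x u w) := by
  simp [riemann]

variable [FiniteDimensional ℝ E]

/-- The trace of an endomorphism, as a continuous linear functional. -/
def traceL (E : Type*) [NormedAddCommGroup E] [NormedSpace ℝ E] [FiniteDimensional ℝ E] :
    (E →L[ℝ] E) →L[ℝ] ℝ :=
  LinearMap.toContinuousLinearMap
    ((LinearMap.trace ℝ E).comp (ContinuousLinearMap.coeLM ℝ (M := E) (N₃ := E)))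

theorem traceL_apply (A : E →L[ℝ] E) : traceL E A = LinearMap.trace ℝ E A.toLinearMap := by
  simp [traceL]

/-- The Ricci tensor, `Ric(v, w) = trace (u ↦ R(u, v) w)`. -/
def ricci (G : E → E →L[ℝ] E →L[ℝ] ℝ) (x : E) : E →L[ℝ] E →L[ℝ] ℝ :=
  (ContinuousLinearMap.compL ℝ E (E →L[ℝ] E) ℝ (traceL E)).comp
    ((ContinuousLinearMap.flipₗᵢ ℝ E E E).toContinuousLinearEquiv.toContinuousLinearMap.comp
      (riemann G x).flip)

theorem ricci_apply (G : E → E →L[ℝ] E →L[ℝ] ℝ) (x v w : E) :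
    ricci G x v w = traceL E (((riemann G x).flip v).flip w) := rfl

/-- The scalar curvature, the metric trace of the Ricci tensor. -/
def scalarCurvature (G : E → E →L[ℝ] E →L[ℝ] ℝ) (x : E) : ℝ :=
  traceL E ((G x).inverse.comp (ricci G x))

/-- The covariant derivative of the Ricci tensor,
`(∇_u Ric)(v, w) = ∂_u Ric(v, w) - Ric(Γ(u, v), w) - Ric(v, Γ(u, w))`. -/
def covDerivRicci (G : E → E →L[ℝ] E →L[ℝ] ℝ) (x u v w : E) : ℝ :=
  fderiv ℝ (ricci G) x u v w - ricci G x (christoffel G x u v) w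
    - ricci G x v (christoffel G x u w)

end Coordinates

section Manifold

variable {E : Type*} [NormedAddCommGroup E] [NormedSpace ℝ E]
  {H : Type*} [TopologicalSpace H] (I : ModelWithCorners ℝ E H)
  {M : Type*} [TopologicalSpace M] [ChartedSpace H M]

/-- A field of bilinear forms on the tangent spaces of the manifold `M`. -/
abbrev BilinField (M : Type*) [TopologicalSpace M] [ChartedSpace H M] : Type _ :=
  ∀ p : M, TangentSpace I p →L[ℝ] TangentSpace I p →L[ℝ] ℝ

variable {I}

/-- The field `g` in the chart `e`: at a point `x` of the range of the chart, the bilinear form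
`(v, w) ↦ g(∂_v, ∂_w)` on `E`, where `∂_v` is the coordinate vector field of direction `v`, the
image of `v` under the derivative of the inverse of the chart. -/
def inChart (g : BilinField I M) (e : OpenPartialHomeomorph M H) (x : E) : E →L[ℝ] E →L[ℝ] ℝ :=
  let A : E →L[ℝ] TangentSpace I ((e.extend I).symm x) :=
    mfderiv 𝓘(ℝ, E) I (e.extend I).symm x
  (ContinuousLinearMap.precomp ℝ A).comp ((g ((e.extend I).symm x)).comp A)

theorem inChart_apply (g : BilinField I M) (e : OpenPartialHomeomorph M H) (x v w : E) :
    inChart g e x v w = g ((e.extend I).symm x)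
      (mfderiv 𝓘(ℝ, E) I (e.extend I).symm x v) (mfderiv 𝓘(ℝ, E) I (e.extend I).symm x w) := rfl

variable [FiniteDimensional ℝ E]

/-! The following are equations between tensors on `M`. They are expressed in the charts of the
atlas of `M`, which cover `M`; as both sides are tensors, the choice of charts is immaterial. -/

/-- The Ricci tensor of `g` is a Killing tensor:
`∇_j R_kl + ∇_k R_lj + ∇_l R_jk = 0`. -/
def RicciIsKilling (g : BilinField I M) : Prop :=
  ∀ e ∈ atlas H M, ∀ x ∈ (e.extend I).target, ∀ u v w : E,
    covDerivRicci (inChart g e) x u v w + covDerivRicci (inChart g e) x v w u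
      + covDerivRicci (inChart g e) x w u v = 0

/-- The Ricci tensor of `g` is parallel: `∇_j R_kl = 0`. -/
def RicciIsParallel (g : BilinField I M) : Prop :=
  ∀ e ∈ atlas H M, ∀ x ∈ (e.extend I).target, ∀ u v w : E,
    covDerivRicci (inChart g e) x u v w = 0

/-- The metric `g` is Einstein: `R_kl = (R / n) g_kl`, where `R` is the scalar curvature and `n`
the dimension. -/
def IsEinstein (g : BilinField I M) : Prop :=
  ∀ e ∈ atlas H M, ∀ x ∈ (e.extend I).target, ∀ v w : E,
    ricci (inChart g e) x v w =
      scalarCurvature (inChart g e) x / (Module.finrank ℝ E : ℝ) * inChart g e x v w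

end Manifold

section GRW

variable {m : ℕ} {M : Type*} [TopologicalSpace M] [ChartedSpace (EuclideanSpace ℝ (Fin m)) M]
  [IsManifold (𝓡 m) ∞ M]

/-- The metric `-dt² + a(t)² g*` of the generalized Robertson-Walker space-time `-J ×_a M`, a
field of bilinear forms on `J × M`, where `J ⊆ ℝ` is open and `g*` a Riemannian metric on `M`:
at `q = (t, p)`, `g(v, w) = a(t)² g*_p(dπ(v), dπ(w)) - dt(v) dt(w)`, with `dt` and `dπ` the
derivatives at `q` of the maps `(t, p) ↦ t` and `π : (t, p) ↦ p`. -/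
def grwMetric (J : TopologicalSpace.Opens ℝ) (a : ℝ → ℝ)
    (gStar : Bundle.ContMDiffRiemannianMetric (𝓡 m) ∞ (EuclideanSpace ℝ (Fin m))
      (fun p : M => TangentSpace (𝓡 m) p)) :
    BilinField (𝓘(ℝ, ℝ).prod (𝓡 m)) (J × M) := fun q =>
  let dt : TangentSpace (𝓘(ℝ, ℝ).prod (𝓡 m)) q →L[ℝ] ℝ :=
    mfderiv (𝓘(ℝ, ℝ).prod (𝓡 m)) 𝓘(ℝ, ℝ) (fun r : J × M => (r.1 : ℝ)) q
  let dπ : TangentSpace (𝓘(ℝ, ℝ).prod (𝓡 m)) q →L[ℝ] TangentSpace (𝓡 m) q.2 :=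
    mfderiv (𝓘(ℝ, ℝ).prod (𝓡 m)) (𝓡 m) (fun r : J × M => r.2) q
  (a (q.1 : ℝ) ^ 2) • (ContinuousLinearMap.precomp ℝ dπ).comp ((gStar.inner q.2).comp dπ)
    - dt.smulRight dt

theorem grwMetric_apply (J : TopologicalSpace.Opens ℝ) (a : ℝ → ℝ)
    (gStar : Bundle.ContMDiffRiemannianMetric (𝓡 m) ∞ (EuclideanSpace ℝ (Fin m))
      (fun p : M => TangentSpace (𝓡 m) p))
    (q : J × M) (v w : TangentSpace (𝓘(ℝ, ℝ).prod (𝓡 m)) q) :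
    grwMetric J a gStar q v w =
      a (q.1 : ℝ) ^ 2 *
        gStar.inner q.2 (mfderiv (𝓘(ℝ, ℝ).prod (𝓡 m)) (𝓡 m) (fun r : J × M => r.2) q v)
          (mfderiv (𝓘(ℝ, ℝ).prod (𝓡 m)) (𝓡 m) (fun r : J × M => r.2) q w)
      - (show ℝ from mfderiv (𝓘(ℝ, ℝ).prod (𝓡 m)) 𝓘(ℝ, ℝ) (fun r : J × M => (r.1 : ℝ)) q v) *
        (show ℝ from mfderiv (𝓘(ℝ, ℝ).prod (𝓡 m)) 𝓘(ℝ, ℝ) (fun r : J × M => (r.1 : ℝ)) q w) :=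
  rfl

end GRW

end SemiRiem

end

/-! In a product chart the metric is `-dt² + a² h`, where `h` is the coordinate form of `g*` and `m
= dim M`. Writing `C = a a'' + (m - 1) a'²` (this is `ricciCoeff`), its Ricci tensor is `Ric_h + C h
- m (a''/a) dt²` (`ricci_eq`), without mixed components.

The Killing equation is needed on two kinds of triples only. On `(∂_t, ∂_t, ∂_t)` it says that
`a''/a` is constant, so `a'' = c a`, and therefore `q = a'² - c a²` is constant too. On `(∂_t, v,
w)` with `v`, `w` tangent to the fibre, once `a'' = c a` is inserted, it becomes `a' (Ric_h + (m -
1) q h) = 0`. As `a` is not constant, `a'` is nonzero at some `t₀`, and evaluation there gives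
`Ric_h = -(m - 1) q h` over the whole fibre, with a coefficient that does not depend on the point.
Substituting back, `Ric = m c g` (`exists_ricci_eq_mul`).

A constant multiple of the metric is parallel because the metric is (`covDerivRicci_eq_zero`), and
tracing identifies the multiple as `R / n` (`scalarCurvature_eq`). The passage from the manifold to
coordinates is `isGRWOn_inChart`. -/

noncomputable section

namespace SemiRiem

/-! ### Levi-Civita calculus of a metric in coordinates. -/

section Coordinates

variable {E : Type*} [NormedAddCommGroup E] [NormedSpace ℝ E]

/-- `G` is a smooth semi-Riemannian metric on the open set `S` of the coordinate space `E`. -/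
structure IsMetricOn (G : E → E →L[ℝ] E →L[ℝ] ℝ) (S : Set E) : Prop where
  isOpen : IsOpen S
  contDiffOn : ContDiffOn ℝ ∞ G S
  symm : ∀ x ∈ S, ∀ v w, G x v w = G x w v
  isInvertible : ∀ x ∈ S, (G x).IsInvertible

theorem hasFDerivAt_apply_apply {D F : Type*} [NormedAddCommGroup D] [NormedSpace ℝ D]
    [NormedAddCommGroup F] [NormedSpace ℝ F]
    {B : D → E →L[ℝ] E →L[ℝ] F} {x : D} (hB : DifferentiableAt ℝ B x) (v w : E) :
    HasFDerivAt (fun y => B y v w) ((fderiv ℝ B x).flip v |>.flip w) x :=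
  ((ContinuousLinearMap.apply ℝ F w ∘L
    ContinuousLinearMap.apply ℝ (E →L[ℝ] F) v).hasFDerivAt).comp x hB.hasFDerivAt

theorem fderiv_apply_apply {D F : Type*} [NormedAddCommGroup D] [NormedSpace ℝ D]
    [NormedAddCommGroup F] [NormedSpace ℝ F]
    {B : D → E →L[ℝ] E →L[ℝ] F} {x : D} (hB : DifferentiableAt ℝ B x) (u : D) (v w : E) :
    fderiv ℝ (fun y => B y v w) x u = fderiv ℝ B x u v w := by
  rw [(hasFDerivAt_apply_apply hB v w).fderiv]; rfl

namespace IsMetricOn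

variable {G : E → E →L[ℝ] E →L[ℝ] ℝ} {S : Set E} {x : E} (hG : IsMetricOn G S)
include hG

theorem differentiableAt (hx : x ∈ S) : DifferentiableAt ℝ G x :=
  (hG.contDiffOn.contDiffAt (hG.isOpen.mem_nhds hx)).differentiableAt (by simp)

theorem fderiv_symm (hx : x ∈ S) (u v w : E) : fderiv ℝ G x u v w = fderiv ℝ G x u w v := by
  rw [← fderiv_apply_apply (hG.differentiableAt hx), ← fderiv_apply_apply (hG.differentiableAt hx)]
  have : (fun y => G y v w) =ᶠ[nhds x] fun y => G y w v :=
    Filter.eventuallyEq_of_mem (hG.isOpen.mem_nhds hx) fun y hy => hG.symm y hy v w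
  rw [this.fderiv_eq]

theorem christoffelFirst_symm (hx : x ∈ S) (v w : E) :
    christoffelFirst G x v w = christoffelFirst G x w v := by
  ext z
  rw [christoffelFirst_apply, christoffelFirst_apply, hG.fderiv_symm hx z v w]
  ring

theorem christoffel_symm (hx : x ∈ S) (v w : E) : christoffel G x v w = christoffel G x w v := by
  rw [christoffel_apply, christoffel_apply, hG.christoffelFirst_symm hx]

theorem apply_christoffel (hx : x ∈ S) (v w : E) :
    G x (christoffel G x v w) = christoffelFirst G x v w := by
  rw [christoffel_apply, (hG.isInvertible x hx).self_apply_inverse]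

theorem christoffel_eq_of_apply_eq (hx : x ∈ S) {v w y : E}
    (h : G x y = christoffelFirst G x v w) : christoffel G x v w = y := by
  rw [christoffel_apply, ← h, (hG.isInvertible x hx).inverse_apply_self]

/-- The metric is parallel. -/
theorem fderiv_eq (hx : x ∈ S) (u v w : E) :
    fderiv ℝ G x u v w = G x (christoffel G x u v) w + G x v (christoffel G x u w) := by
  rw [hG.symm x hx v, hG.apply_christoffel hx, hG.apply_christoffel hx, christoffelFirst_apply,
    christoffelFirst_apply, hG.fderiv_symm hx u w v, hG.fderiv_symm hx w u v,
    hG.fderiv_symm hx v u w]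
  ring

theorem contDiffOn_christoffelFirst : ContDiffOn ℝ ∞ (christoffelFirst G) S := by
  have hD : ContDiffOn ℝ ∞ (fderiv ℝ G) S := hG.contDiffOn.fderiv_of_isOpen hG.isOpen (by simp)
  have hf : ContDiffOn ℝ ∞ (fun x => (fderiv ℝ G x).flip) S :=
    (ContinuousLinearMap.flipₗᵢ ℝ E E (E →L[ℝ] ℝ)).toContinuousLinearEquiv.contDiff.comp_contDiffOn
      hD
  exact ((hD.add hf).sub (contDiffOn_const.clm_comp hf)).const_smul (1 / 2 : ℝ)

theorem contDiffOn_inverse [CompleteSpace E] : ContDiffOn ℝ ∞ (fun x => (G x).inverse) S :=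
  fun x hx => (hG.isInvertible x hx).contDiffAt_map_inverse.comp_contDiffWithinAt x
    (hG.contDiffOn x hx)

theorem contDiffOn_christoffel [CompleteSpace E] : ContDiffOn ℝ ∞ (christoffel G) S :=
  ((ContinuousLinearMap.compL ℝ E (E →L[ℝ] ℝ) E).contDiff.comp_contDiffOn
    hG.contDiffOn_inverse).clm_comp hG.contDiffOn_christoffelFirst

theorem differentiableAt_christoffel [CompleteSpace E] (hx : x ∈ S) :
    DifferentiableAt ℝ (christoffel G) x :=
  (hG.contDiffOn_christoffel.contDiffAt (hG.isOpen.mem_nhds hx)).differentiableAt (by simp)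

theorem contDiffOn_riemann [FiniteDimensional ℝ E] : ContDiffOn ℝ ∞ (riemann G) S := by
  have : CompleteSpace E := FiniteDimensional.complete ℝ E
  have hC := hG.contDiffOn_christoffel
  have hD : ContDiffOn ℝ ∞ (fderiv ℝ (christoffel G)) S := hC.fderiv_of_isOpen hG.isOpen (by simp)
  have hc : ∀ v w : E, ContDiffOn ℝ ∞ (fun x => christoffel G x v w) S := fun v w =>
    (hC.clm_apply contDiffOn_const).clm_apply contDiffOn_const
  refine contDiffOn_clm_apply.2 fun u => contDiffOn_clm_apply.2 fun v =>
    contDiffOn_clm_apply.2 fun w => ?_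
  simp only [riemann_apply]
  have hd : ∀ u v : E, ContDiffOn ℝ ∞ (fun x => fderiv ℝ (christoffel G) x u v w) S := fun u v =>
    ((hD.clm_apply contDiffOn_const).clm_apply contDiffOn_const).clm_apply contDiffOn_const
  have hq : ∀ u v : E, ContDiffOn ℝ ∞
      (fun x => christoffel G x u (christoffel G x v w)) S := fun u v =>
    (hC.clm_apply contDiffOn_const).clm_apply (hc v w)
  exact (((hd u v).sub (hd v u)).add (hq u v)).sub (hq v u)

theorem contDiffOn_ricci [FiniteDimensional ℝ E] : ContDiffOn ℝ ∞ (ricci G) S := by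
  refine contDiffOn_clm_apply.2 fun v => contDiffOn_clm_apply.2 fun w => ?_
  simp only [ricci_apply]
  have h : ContDiffOn ℝ ∞ (fun x => ((riemann G x).flip v).flip w) S :=
    contDiffOn_clm_apply.2 fun u => by
      simp only [ContinuousLinearMap.flip_apply]
      exact ((hG.contDiffOn_riemann.clm_apply contDiffOn_const).clm_apply
        contDiffOn_const).clm_apply contDiffOn_const
  exact (traceL E).contDiff.comp_contDiffOn h

theorem differentiableAt_ricci [FiniteDimensional ℝ E] (hx : x ∈ S) :
    DifferentiableAt ℝ (ricci G) x :=
  (hG.contDiffOn_ricci.contDiffAt (hG.isOpen.mem_nhds hx)).differentiableAt (by simp)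

theorem fderiv_christoffel_symm [CompleteSpace E] (hx : x ∈ S) (u v w : E) :
    fderiv ℝ (christoffel G) x u v w = fderiv ℝ (christoffel G) x u w v := by
  have hd := hG.differentiableAt_christoffel hx
  rw [← fderiv_apply_apply hd, ← fderiv_apply_apply hd]
  have : (fun y => christoffel G y v w) =ᶠ[nhds x] fun y => christoffel G y w v :=
    Filter.eventuallyEq_of_mem (hG.isOpen.mem_nhds hx) fun y hy => hG.christoffel_symm hy v w
  rw [this.fderiv_eq]

/-- The first Bianchi identity. -/
theorem bianchi [CompleteSpace E] (hx : x ∈ S) (u v w : E) :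
    riemann G x u v w + riemann G x v w u + riemann G x w u v = 0 := by
  simp only [riemann_apply, hG.fderiv_christoffel_symm hx u w v,
    hG.fderiv_christoffel_symm hx v w u, hG.fderiv_christoffel_symm hx w v u,
    hG.christoffel_symm hx w v, hG.christoffel_symm hx w u, hG.christoffel_symm hx v u]
  abel

/-- The curvature operators are skew-adjoint. -/
theorem apply_riemann_self [CompleteSpace E] (hx : x ∈ S) (u v z : E) :
    G x (riemann G x u v z) z = 0 := by
  have hd := hG.differentiableAt hx
  have hC := hG.differentiableAt_christoffel hx
  have hD : DifferentiableAt ℝ (fderiv ℝ G) x :=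
    ((hG.contDiffOn.fderiv_of_isOpen hG.isOpen (m := ∞) (by simp)).contDiffAt
      (hG.isOpen.mem_nhds hx)).differentiableAt (by simp)
  have hsymm : fderiv ℝ (fderiv ℝ G) x u v = fderiv ℝ (fderiv ℝ G) x v u :=
    ((hG.contDiffOn.contDiffAt (hG.isOpen.mem_nhds hx)).isSymmSndFDerivAt
      (by simpa only [minSmoothness_of_isRCLikeNormedField] using ENat.LEInfty.out)).eq u v
  -- Differentiate the compatibility relation `∂_v g(z, z) = 2 g(Γ(v, z), z)` once more along `u`.
  -- The left side is symmetric in `u`, `v`; antisymmetrizing the right side leaves `2 g(R(u, v) z,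
  -- z)`.
  have key : ∀ u v : E, fderiv ℝ (fderiv ℝ G) x u v z z =
      2 * (G x (christoffel G x u (christoffel G x v z)) z
        + G x (christoffel G x v z) (christoffel G x u z)
        + G x (fderiv ℝ (christoffel G) x u v z) z) := by
    intro u v
    have h1 : HasFDerivAt (fun y => fderiv ℝ G y v z z)
        ((((fderiv ℝ (fderiv ℝ G) x).flip v).flip z).flip z) x :=
      ((ContinuousLinearMap.apply ℝ ℝ z ∘L ContinuousLinearMap.apply ℝ (E →L[ℝ] ℝ) z ∘L
        ContinuousLinearMap.apply ℝ (E →L[ℝ] E →L[ℝ] ℝ) v).hasFDerivAt).comp x hD.hasFDerivAt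
    have h2 := ((hd.hasFDerivAt.clm_apply (hasFDerivAt_apply_apply hC v z)).clm_apply
      (hasFDerivAt_const z x)).const_mul (2 : ℝ)
    have h3 : (fun y => fderiv ℝ G y v z z) =ᶠ[nhds x]
        fun y => 2 * G y (christoffel G y v z) z :=
      Filter.eventuallyEq_of_mem (hG.isOpen.mem_nhds hx) fun y hy => by
        simp only [hG.fderiv_eq hy v z z, hG.symm y hy z]
        ring
    have h4 := congrArg (fun L => L u) ((h1.congr_of_eventuallyEq h3.symm).unique h2)
    simp only [ContinuousLinearMap.flip_apply, _root_.smul_apply,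
      _root_.add_apply, ContinuousLinearMap.comp_apply, smul_eq_mul,
      _root_.zero_apply, map_zero, zero_add] at h4
    rw [h4, hG.fderiv_eq hx]
    ring
  have h := key u v
  rw [hsymm, key v u, hG.symm x hx (christoffel G x v z)] at h
  simp only [riemann_apply, map_add, map_sub, _root_.add_apply,
    _root_.sub_apply]
  linarith

end IsMetricOn

/-- The isomorphism `E ≃ E*` given by `B` conjugates `A` to minus its transpose, so the trace of `A`
equals its own negative. -/
theorem traceL_eq_zero_of_skew [FiniteDimensional ℝ E] {B : E →L[ℝ] E →L[ℝ] ℝ}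
    (hB : B.IsInvertible) (hsymm : ∀ v w, B v w = B w v) {A : E →L[ℝ] E}
    (hA : ∀ z, B (A z) z = 0) : traceL E A = 0 := by
  obtain ⟨e, rfl⟩ := hB
  have hskew : ∀ v w, e (A v) w = - e (A w) v := by
    intro v w
    have h := hA (v + w)
    have hv := hA v
    have hw := hA w
    simp only [ContinuousLinearEquiv.coe_coe] at h hv hw
    simp only [map_add, _root_.add_apply] at h
    linarith
  let f : E ≃ₗ[ℝ] Module.Dual ℝ E := e.toLinearEquiv.trans LinearMap.toContinuousLinearMap.symm
  have hf : ∀ v w, f v w = e v w := fun v w => rfl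
  have h1 : f.conj A.toLinearMap = - Module.Dual.transpose (R := ℝ) A.toLinearMap := by
    ext φ w
    obtain ⟨v, rfl⟩ := f.surjective φ
    simp only [LinearEquiv.conj_apply_apply, LinearEquiv.symm_apply_apply, LinearMap.neg_apply,
      Module.Dual.transpose_apply, LinearMap.comp_apply, hf]
    simp only [ContinuousLinearMap.coe_coe]
    rw [hskew]
    exact congrArg Neg.neg (hsymm _ _)
  have h2 := LinearMap.trace_conj' A.toLinearMap f
  rw [h1, map_neg, LinearMap.trace_transpose'] at h2
  rw [traceL_apply]
  linarith

namespace IsMetricOn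

variable [FiniteDimensional ℝ E] {G : E → E →L[ℝ] E →L[ℝ] ℝ} {S : Set E} {x : E}
  (hG : IsMetricOn G S)
include hG

/-- By the first Bianchi identity, `Ric(w, v) - Ric(v, w)` is the trace of `R(v, w)`, which vanishes
because that operator is skew-adjoint. -/
theorem ricci_symm (hx : x ∈ S) (v w : E) : ricci G x v w = ricci G x w v := by
  have : CompleteSpace E := FiniteDimensional.complete ℝ E
  have h0 : traceL E (riemann G x v w) = 0 :=
    traceL_eq_zero_of_skew (hG.isInvertible x hx) (hG.symm x hx)
      fun z => hG.apply_riemann_self hx v w z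
  have h1 : ((riemann G x).flip v).flip w + riemann G x v w = ((riemann G x).flip w).flip v := by
    ext u
    have h := hG.bianchi hx u v w
    have h' : riemann G x w u v = - riemann G x u w v := by
      simp only [riemann_apply]; abel
    rw [h', add_neg_eq_zero] at h
    exact h
  rw [ricci_apply, ricci_apply, ← h1, map_add, h0, add_zero]

/-- Where the Ricci tensor is a constant multiple of the metric, it is parallel. -/
theorem covDerivRicci_eq_zero {κ : ℝ} (h : ∀ x ∈ S, ∀ v w, ricci G x v w = κ * G x v w)
    (hx : x ∈ S) (u v w : E) : covDerivRicci G x u v w = 0 := by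
  have h1 : (fun y => ricci G y v w) =ᶠ[nhds x] fun y => κ * G y v w :=
    Filter.eventuallyEq_of_mem (hG.isOpen.mem_nhds hx) fun y hy => h y hy v w
  have h2 := ((hasFDerivAt_apply_apply (hG.differentiableAt hx) v w).const_mul κ)
  rw [covDerivRicci, ← fderiv_apply_apply (hG.differentiableAt_ricci hx), h1.fderiv_eq, h2.fderiv,
    h x hx, h x hx]
  simp only [_root_.smul_apply, ContinuousLinearMap.flip_apply, smul_eq_mul,
    hG.fderiv_eq hx u v w]
  ring

theorem scalarCurvature_eq {κ : ℝ} (hx : x ∈ S) (h : ∀ v w, ricci G x v w = κ * G x v w) :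
    scalarCurvature G x = κ * Module.finrank ℝ E := by
  have : ricci G x = κ • G x := by ext v w; simp [h]
  rw [scalarCurvature, this, ContinuousLinearMap.comp_smul,
    (hG.isInvertible x hx).inverse_comp_self, map_smul, traceL_apply]
  simp

end IsMetricOn

end Coordinates
end SemiRiem

namespace SemiRiem

/-! ### Curvature of the warped product `-dt² + a(t)² h`. -/

section WarpedProduct

theorem isInvertible_of_nondegenerate {E : Type*} [NormedAddCommGroup E] [NormedSpace ℝ E]
    [FiniteDimensional ℝ E] {B : E →L[ℝ] E →L[ℝ] ℝ} (hB : ∀ v, (∀ w, B v w = 0) → v = 0) :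
    B.IsInvertible := by
  have hinj : Function.Injective B.toLinearMap := by
    rw [← LinearMap.ker_eq_bot, LinearMap.ker_eq_bot']
    intro v hv
    exact hB v fun w => by
      have := congrArg (fun L : E →L[ℝ] ℝ => L w) hv
      simpa using this
  have hfin : Module.finrank ℝ E = Module.finrank ℝ (E →L[ℝ] ℝ) := by
    rw [← (LinearMap.toContinuousLinearMap (𝕜 := ℝ) (E := E) (F' := ℝ)).finrank_eq]
    exact (Subspace.dual_finrank_eq (K := ℝ) (V := E)).symm
  exact ⟨(LinearMap.linearEquivOfInjective B.toLinearMap hinj hfin).toContinuousLinearEquiv, rfl⟩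

/-- The trace of an endomorphism of a product with a line. -/
theorem traceL_prod {V : Type*} [NormedAddCommGroup V] [NormedSpace ℝ V] [FiniteDimensional ℝ V]
    (A : (ℝ × V) →L[ℝ] (ℝ × V)) :
    traceL (ℝ × V) A = (A (1, 0)).1 + traceL V
      ((ContinuousLinearMap.snd ℝ ℝ V).comp (A.comp (ContinuousLinearMap.inr ℝ ℝ V))) := by
  -- Split `A` along the two projections; cyclicity of the trace then turns each summand into a
  -- diagonal block.
  have h1 : A.toLinearMap = (A.toLinearMap ∘ₗ LinearMap.inl ℝ ℝ V) ∘ₗ LinearMap.fst ℝ ℝ V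
      + (A.toLinearMap ∘ₗ LinearMap.inr ℝ ℝ V) ∘ₗ LinearMap.snd ℝ ℝ V := by
    refine LinearMap.ext fun x => ?_
    simp [← map_add]
  rw [traceL_apply, h1, map_add, LinearMap.trace_comp_comm' (LinearMap.fst ℝ ℝ V),
    LinearMap.trace_comp_comm' (LinearMap.snd ℝ ℝ V), traceL_apply]
  congr 1
  have h2 : LinearMap.fst ℝ ℝ V ∘ₗ (A.toLinearMap ∘ₗ LinearMap.inl ℝ ℝ V)
      = (A (1, 0)).1 • LinearMap.id := by
    ext; simp
  rw [h2, map_smul, LinearMap.trace_id]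
  simp

variable {V : Type*} [NormedAddCommGroup V] [NormedSpace ℝ V]

/-- In the coordinates `J × U`, `G` is the metric `-dt² + a(t)² h`. -/
structure IsGRWOn (a : ℝ → ℝ) (J : Set ℝ) (h : V → V →L[ℝ] V →L[ℝ] ℝ) (U : Set V)
    (G : ℝ × V → (ℝ × V) →L[ℝ] (ℝ × V) →L[ℝ] ℝ) : Prop where
  isOpen : IsOpen J
  contDiffOn : ContDiffOn ℝ ∞ a J
  ne_zero : ∀ t ∈ J, a t ≠ 0
  isMetricOn_fiber : IsMetricOn h U
  apply_eq : ∀ t ∈ J, ∀ y ∈ U, ∀ v w : ℝ × V,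
    G (t, y) v w = a t ^ 2 * h y v.2 w.2 - v.1 * w.1

/-- The coefficient `a a'' + (m - 1) a'²` of `g*` in the Ricci tensor of `-dt² + a(t)² g*`, where
`m = dim V`. -/
def ricciCoeff (V : Type*) [NormedAddCommGroup V] [NormedSpace ℝ V] (a : ℝ → ℝ)
    (t : ℝ) : ℝ :=
  a t * deriv (deriv a) t + ((Module.finrank ℝ V : ℝ) - 1) * deriv a t ^ 2

namespace IsGRWOn

variable {a : ℝ → ℝ} {J : Set ℝ} {h : V → V →L[ℝ] V →L[ℝ] ℝ} {U : Set V}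
  {G : ℝ × V → (ℝ × V) →L[ℝ] (ℝ × V) →L[ℝ] ℝ} [FiniteDimensional ℝ V]
  (hG : IsGRWOn a J h U G) {t : ℝ} {y : V}
include hG

theorem isMetricOn : IsMetricOn G (J ×ˢ U) where
  isOpen := hG.isOpen.prod hG.isMetricOn_fiber.isOpen
  contDiffOn := by
    refine contDiffOn_clm_apply.2 fun v => contDiffOn_clm_apply.2 fun w => ?_
    have h1 : ContDiffOn ℝ ∞ (fun x : ℝ × V => a x.1 ^ 2 * h x.2 v.2 w.2 - v.1 * w.1) (J ×ˢ U) := by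
      have ha : ContDiffOn ℝ ∞ (fun x : ℝ × V => a x.1) (J ×ˢ U) :=
        hG.contDiffOn.comp contDiff_fst.contDiffOn fun x hx => hx.1
      have hh : ContDiffOn ℝ ∞ (fun x : ℝ × V => h x.2) (J ×ˢ U) :=
        hG.isMetricOn_fiber.contDiffOn.comp contDiff_snd.contDiffOn fun x hx => hx.2
      exact ((ha.pow 2).mul ((hh.clm_apply contDiffOn_const).clm_apply contDiffOn_const)).sub
        contDiffOn_const
    exact h1.congr fun x hx => hG.apply_eq x.1 hx.1 x.2 hx.2 v w
  symm x hx v w := by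
    rw [← Prod.mk.eta (p := x), hG.apply_eq _ hx.1 _ hx.2, hG.apply_eq _ hx.1 _ hx.2,
      hG.isMetricOn_fiber.symm _ hx.2]
    ring
  isInvertible x hx := by
    refine isInvertible_of_nondegenerate fun v hv => ?_
    have hv' : ∀ w : ℝ × V, a x.1 ^ 2 * h x.2 v.2 w.2 - v.1 * w.1 = 0 := fun w => by
      rw [← hG.apply_eq _ hx.1 _ hx.2]; exact hv w
    have h1 : v.1 = 0 := by simpa using hv' (1, 0)
    have h2 : v.2 = 0 := by
      have h3 : h x.2 v.2 = 0 := by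
        ext w
        simpa [hG.ne_zero _ hx.1] using hv' (0, w)
      rw [← (hG.isMetricOn_fiber.isInvertible _ hx.2).inverse_apply_self v.2, h3, map_zero]
    exact Prod.ext h1 h2

omit [FiniteDimensional ℝ V] in
theorem contDiffOn_deriv : ContDiffOn ℝ ∞ (deriv a) J :=
  hG.contDiffOn.deriv_of_isOpen hG.isOpen (by simp)

omit [FiniteDimensional ℝ V] in
theorem hasDerivAt (ht : t ∈ J) : HasDerivAt a (deriv a t) t :=
  ((hG.contDiffOn.contDiffAt (hG.isOpen.mem_nhds ht)).differentiableAt (by simp)).hasDerivAt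

omit [FiniteDimensional ℝ V] in
theorem hasDerivAt_deriv (ht : t ∈ J) : HasDerivAt (deriv a) (deriv (deriv a) t) t :=
  ((hG.contDiffOn_deriv.contDiffAt (hG.isOpen.mem_nhds ht)).differentiableAt (by simp)).hasDerivAt

omit [FiniteDimensional ℝ V] in
theorem hasDerivAt_deriv_deriv (ht : t ∈ J) :
    HasDerivAt (deriv (deriv a)) (deriv (deriv (deriv a)) t) t :=
  ((hG.contDiffOn_deriv.deriv_of_isOpen hG.isOpen (m := ∞) (by simp) |>.contDiffAt
    (hG.isOpen.mem_nhds ht)).differentiableAt (by simp)).hasDerivAt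

omit hG [FiniteDimensional ℝ V] in
theorem hasFDerivAt_comp_fst {F : Type*} [NormedAddCommGroup F] [NormedSpace ℝ F]
    {f : ℝ → F} {f' : F} (hf : HasDerivAt f f' t) :
    HasFDerivAt (fun x : ℝ × V => f x.1) ((ContinuousLinearMap.fst ℝ ℝ V).smulRight f') (t, y) := by
  have := HasFDerivAt.comp (t, y) (f := Prod.fst) (g := f) hf.hasFDerivAt
    (ContinuousLinearMap.fst ℝ ℝ V).hasFDerivAt
  have h : (ContinuousLinearMap.fst ℝ ℝ V).smulRight f'
      = (ContinuousLinearMap.toSpanSingleton ℝ f').comp (ContinuousLinearMap.fst ℝ ℝ V) := by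
    refine ContinuousLinearMap.ext fun x => ?_
    simp
  rw [h]
  exact this

omit hG [FiniteDimensional ℝ V] in
theorem hasFDerivAt_comp_snd {F : Type*} [NormedAddCommGroup F] [NormedSpace ℝ F]
    {f : V → F} {f' : V →L[ℝ] F} (hf : HasFDerivAt f f' y) :
    HasFDerivAt (fun x : ℝ × V => f x.2) (f'.comp (ContinuousLinearMap.snd ℝ ℝ V)) (t, y) :=
  HasFDerivAt.comp (t, y) (f := Prod.snd) (g := f) hf (ContinuousLinearMap.snd ℝ ℝ V).hasFDerivAt

theorem fderiv_eq (ht : t ∈ J) (hy : y ∈ U) (u v w : ℝ × V) :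
    fderiv ℝ G (t, y) u v w =
      2 * a t * deriv a t * u.1 * h y v.2 w.2 + a t ^ 2 * fderiv ℝ h y u.2 v.2 w.2 := by
  have hx : (t, y) ∈ J ×ˢ U := ⟨ht, hy⟩
  rw [← fderiv_apply_apply (hG.isMetricOn.differentiableAt hx)]
  have h1 : (fun x => G x v w) =ᶠ[nhds (t, y)]
      fun x => a x.1 ^ 2 * h x.2 v.2 w.2 - v.1 * w.1 :=
    Filter.eventuallyEq_of_mem (hG.isMetricOn.isOpen.mem_nhds hx)
      fun x hx => hG.apply_eq x.1 hx.1 x.2 hx.2 v w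
  have h2 := (((hasFDerivAt_comp_fst (y := y) ((hG.hasDerivAt ht).pow 2)).mul
    (hasFDerivAt_comp_snd (t := t) (hasFDerivAt_apply_apply
      (hG.isMetricOn_fiber.differentiableAt hy) v.2 w.2)))).sub_const (v.1 * w.1)
  rw [h1.fderiv_eq]
  refine (congrArg (fun L => L u) h2.fderiv).trans ?_
  simp
  ring

/-- Since the metric is invertible, it suffices to lower the index of the proposed vector and
compare with the Christoffel symbols of the first kind. -/
theorem christoffel_eq (ht : t ∈ J) (hy : y ∈ U) (v w : ℝ × V) :
    christoffel G (t, y) v w = (a t * deriv a t * h y v.2 w.2,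
      christoffel h y v.2 w.2 + (deriv a t / a t) • (v.1 • w.2 + w.1 • v.2)) := by
  refine hG.isMetricOn.christoffel_eq_of_apply_eq (⟨ht, hy⟩ : (t, y) ∈ J ×ˢ U) ?_
  refine ContinuousLinearMap.ext fun z => ?_
  have h1 := hG.isMetricOn_fiber.apply_christoffel hy v.2 w.2
  have h0 := hG.ne_zero t ht
  rw [hG.apply_eq t ht y hy, christoffelFirst_apply, hG.fderiv_eq ht hy, hG.fderiv_eq ht hy,
    hG.fderiv_eq ht hy]
  simp only [map_add, map_smul, _root_.add_apply, _root_.smul_apply, h1, christoffelFirst_apply,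
    smul_eq_mul]
  field_simp
  ring

theorem fderiv_christoffel_eq (ht : t ∈ J) (hy : y ∈ U) (u v w : ℝ × V) :
    fderiv ℝ (christoffel G) (t, y) u v w =
      (u.1 * (deriv a t ^ 2 + a t * deriv (deriv a) t) * h y v.2 w.2
        + a t * deriv a t * fderiv ℝ h y u.2 v.2 w.2,
      fderiv ℝ (christoffel h) y u.2 v.2 w.2
        + (u.1 * (deriv (deriv a) t / a t - (deriv a t / a t) ^ 2)) • (v.1 • w.2 + w.1 • v.2)) := by
  have : CompleteSpace V := FiniteDimensional.complete ℝ V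
  have hx : (t, y) ∈ J ×ˢ U := ⟨ht, hy⟩
  have h0 := hG.ne_zero t ht
  rw [← fderiv_apply_apply (hG.isMetricOn.differentiableAt_christoffel hx)]
  have h1 : (fun x => christoffel G x v w) =ᶠ[nhds (t, y)]
      fun x => (a x.1 * deriv a x.1 * h x.2 v.2 w.2,
      christoffel h x.2 v.2 w.2 + (deriv a x.1 / a x.1) • (v.1 • w.2 + w.1 • v.2)) :=
    Filter.eventuallyEq_of_mem (hG.isMetricOn.isOpen.mem_nhds hx)
      fun x hx => hG.christoffel_eq hx.1 hx.2 v w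
  have h2 := (hasFDerivAt_comp_fst (y := y) ((hG.hasDerivAt ht).mul (hG.hasDerivAt_deriv ht))).mul
    (hasFDerivAt_comp_snd (t := t) (hasFDerivAt_apply_apply
      (hG.isMetricOn_fiber.differentiableAt hy) v.2 w.2))
  have h3 := (hasFDerivAt_comp_snd (t := t) (hasFDerivAt_apply_apply
      (hG.isMetricOn_fiber.differentiableAt_christoffel hy) v.2 w.2)).add
    ((hasFDerivAt_comp_fst (y := y) ((hG.hasDerivAt_deriv ht).div (hG.hasDerivAt ht) h0)).smul_const
      (v.1 • w.2 + w.1 • v.2))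
  rw [h1.fderiv_eq]
  refine (congrArg (fun L => L u) (h2.prodMk h3).fderiv).trans ?_
  refine Prod.ext ?_ ?_
  · simp
    ring
  · simp only [ContinuousLinearMap.prod_apply, _root_.add_apply, ContinuousLinearMap.comp_apply,
      ContinuousLinearMap.flip_apply, ContinuousLinearMap.smulRight_apply,
      ContinuousLinearMap.coe_snd', ContinuousLinearMap.coe_fst', smul_eq_mul]
    congr 2
    field_simp

/-- This and `riemann_apply_snd` are the two diagonal blocks of `u ↦ R(u, v) w`, all that its trace
sees. -/
theorem riemann_apply_fst (ht : t ∈ J) (hy : y ∈ U) (v w : ℝ × V) :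
    (riemann G (t, y) (1, 0) v w).1 = a t * deriv (deriv a) t * h y v.2 w.2 := by
  have h0 := hG.ne_zero t ht
  rw [riemann_apply]
  simp only [hG.fderiv_christoffel_eq ht hy, hG.christoffel_eq ht hy, Prod.fst_add, Prod.fst_sub,
    map_zero, _root_.zero_apply, map_add, map_smul, smul_eq_mul, smul_zero, one_smul, add_zero,
    zero_add]
  field_simp
  ring

theorem riemann_apply_snd (ht : t ∈ J) (hy : y ∈ U) (u : V) (v w : ℝ × V) :
    (riemann G (t, y) (0, u) v w).2 = riemann h y u v.2 w.2
      + (deriv a t ^ 2 * h y v.2 w.2 - deriv (deriv a) t / a t * (v.1 * w.1)) • u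
      - (deriv a t ^ 2 * h y u w.2) • v.2 := by
  have h0 := hG.ne_zero t ht
  rw [riemann_apply, riemann_apply]
  simp only [hG.fderiv_christoffel_eq ht hy, hG.christoffel_eq ht hy, Prod.snd_add, Prod.snd_sub,
    map_add, map_smul, smul_eq_mul, zero_smul, zero_add,
    hG.isMetricOn_fiber.christoffel_symm hy v.2 u]
  match_scalars <;> field_simp <;> ring

theorem ricci_eq (ht : t ∈ J) (hy : y ∈ U) (v w : ℝ × V) :
    ricci G (t, y) v w = ricci h y v.2 w.2 + ricciCoeff V a t * h y v.2 w.2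
      - Module.finrank ℝ V * (deriv (deriv a) t / a t) * (v.1 * w.1) := by
  have h1 : (ContinuousLinearMap.snd ℝ ℝ V).comp ((((riemann G (t, y)).flip v).flip w).comp
      (ContinuousLinearMap.inr ℝ ℝ V)) = ((riemann h y).flip v.2).flip w.2
      + (deriv a t ^ 2 * h y v.2 w.2 - deriv (deriv a) t / a t * (v.1 * w.1)) •
        ContinuousLinearMap.id ℝ V
      - deriv a t ^ 2 • ((h y).flip w.2).smulRight v.2 := by
    refine ContinuousLinearMap.ext fun u => ?_
    simp [hG.riemann_apply_snd ht hy, mul_smul]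
  have h2 : traceL V (ContinuousLinearMap.id ℝ V) = Module.finrank ℝ V := by
    rw [traceL_apply]; simp
  have h3 : traceL V (((h y).flip w.2).smulRight v.2) = h y v.2 w.2 := by
    rw [traceL_apply]
    exact LinearMap.trace_smulRight ((h y).flip w.2).toLinearMap v.2
  rw [ricci_apply, traceL_prod, h1, map_sub, map_add, map_smul, map_smul, h2, h3, ← ricci_apply]
  simp only [ContinuousLinearMap.flip_apply, hG.riemann_apply_fst ht hy, ricciCoeff, smul_eq_mul]
  ring

end IsGRWOn
end WarpedProduct
end SemiRiem

namespace SemiRiem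

/-! ### The Killing equation on the warped product. -/

section WarpedProduct

variable {V : Type*} [NormedAddCommGroup V] [NormedSpace ℝ V]

namespace IsGRWOn

variable {a : ℝ → ℝ} {J : Set ℝ} {h : V → V →L[ℝ] V →L[ℝ] ℝ} {U : Set V}
  {G : ℝ × V → (ℝ × V) →L[ℝ] (ℝ × V) →L[ℝ] ℝ} [FiniteDimensional ℝ V]
  (hG : IsGRWOn a J h U G) {t : ℝ} {y : V}
include hG

omit [FiniteDimensional ℝ V] in
theorem hasDerivAt_ricciCoeff (ht : t ∈ J) :
    HasDerivAt (ricciCoeff V a) (deriv a t * deriv (deriv a) t + a t * deriv (deriv (deriv a)) t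
      + ((Module.finrank ℝ V : ℝ) - 1) * (2 * deriv a t * deriv (deriv a) t)) t := by
  have h1 := ((hG.hasDerivAt ht).mul (hG.hasDerivAt_deriv_deriv ht)).add
    (((hG.hasDerivAt_deriv ht).pow 2).const_mul ((Module.finrank ℝ V : ℝ) - 1))
  refine h1.congr_deriv ?_
  simp

/-- Only the derivative along `∂_t` is needed, so the formula for Ricci is differentiated along the
curve `s ↦ (s, y)`, on which `Ric_h` is fixed. -/
theorem fderiv_ricci_eq (ht : t ∈ J) (hy : y ∈ U) (v w : ℝ × V) :
    fderiv ℝ (ricci G) (t, y) (1, 0) v w = deriv (ricciCoeff V a) t * h y v.2 w.2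
      - Module.finrank ℝ V * deriv (fun s => deriv (deriv a) s / a s) t * (v.1 * w.1) := by
  have hx : (t, y) ∈ J ×ˢ U := ⟨ht, hy⟩
  have h1 : HasDerivAt (fun s => ricci G (s, y) v w)
      (fderiv ℝ (ricci G) (t, y) (1, 0) v w) t :=
    HasFDerivAt.comp_hasDerivAt (f := fun s => (s, y)) t
      (hasFDerivAt_apply_apply (hG.isMetricOn.differentiableAt_ricci hx) v w)
      ((hasDerivAt_id t).prodMk (hasDerivAt_const t y))
  have h2 := (((hG.hasDerivAt_ricciCoeff ht).differentiableAt.hasDerivAt.mul_const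
    (h y v.2 w.2)).const_add (ricci h y v.2 w.2)).sub
    (((((hG.hasDerivAt_deriv_deriv ht).div (hG.hasDerivAt ht)
      (hG.ne_zero t ht)).differentiableAt.hasDerivAt).const_mul
      (Module.finrank ℝ V : ℝ)).mul_const (v.1 * w.1))
  refine h1.unique (h2.congr_of_eventuallyEq ?_)
  exact Filter.eventuallyEq_of_mem (hG.isOpen.mem_nhds ht) fun s hs => hG.ricci_eq hs hy v w

theorem covDerivRicci_time_time_time (ht : t ∈ J) (hy : y ∈ U) :
    covDerivRicci G (t, y) (1, 0) (1, 0) (1, 0)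
      = - Module.finrank ℝ V * deriv (fun s => deriv (deriv a) s / a s) t := by
  rw [covDerivRicci, hG.fderiv_ricci_eq ht hy, hG.christoffel_eq ht hy, hG.ricci_eq ht hy,
    hG.ricci_eq ht hy]
  simp

theorem covDerivRicci_time_space_space (ht : t ∈ J) (hy : y ∈ U) (v w : V) :
    covDerivRicci G (t, y) (1, 0) (0, v) (0, w) = deriv (ricciCoeff V a) t * h y v w
      - 2 * (deriv a t / a t) * (ricci h y v w + ricciCoeff V a t * h y v w) := by
  rw [covDerivRicci, hG.fderiv_ricci_eq ht hy, hG.christoffel_eq ht hy, hG.christoffel_eq ht hy,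
    hG.ricci_eq ht hy, hG.ricci_eq ht hy]
  simp
  ring

/-- The mixed components of Ricci vanish identically, hence so does their derivative; only the two
Christoffel corrections survive. -/
theorem covDerivRicci_space_space_time (ht : t ∈ J) (hy : y ∈ U) (v w : V) :
    covDerivRicci G (t, y) (0, v) (0, w) (1, 0) =
      Module.finrank ℝ V * deriv a t * deriv (deriv a) t * h y v w
      - (deriv a t / a t) * (ricci h y v w + ricciCoeff V a t * h y v w) := by
  have hx : (t, y) ∈ J ×ˢ U := ⟨ht, hy⟩
  have h0 := hG.ne_zero t ht
  have h1 : (fun x => ricci G x (0, w) (1, 0)) =ᶠ[nhds (t, y)] fun _ => 0 :=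
    Filter.eventuallyEq_of_mem (hG.isMetricOn.isOpen.mem_nhds hx) fun x hx => by
      have := hG.ricci_eq hx.1 hx.2 (0, w) (1, 0)
      simpa using this
  rw [covDerivRicci, ← fderiv_apply_apply (hG.isMetricOn.differentiableAt_ricci hx), h1.fderiv_eq,
    hG.christoffel_eq ht hy, hG.christoffel_eq ht hy, hG.ricci_eq ht hy, hG.ricci_eq ht hy]
  simp [hG.isMetricOn_fiber.ricci_symm hy w v, hG.isMetricOn_fiber.symm y hy w v]
  field_simp

theorem covDerivRicci_space_time_space (ht : t ∈ J) (hy : y ∈ U) (v w : V) :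
    covDerivRicci G (t, y) (0, v) (1, 0) (0, w) =
      Module.finrank ℝ V * deriv a t * deriv (deriv a) t * h y v w
      - (deriv a t / a t) * (ricci h y v w + ricciCoeff V a t * h y v w) := by
  rw [← hG.covDerivRicci_space_space_time ht hy, covDerivRicci, covDerivRicci]
  have hx : (t, y) ∈ J ×ˢ U := ⟨ht, hy⟩
  have hd := hG.isMetricOn.differentiableAt_ricci hx
  have h1 : (fun x => ricci G x (1, 0) (0, w)) =ᶠ[nhds (t, y)] fun x => ricci G x (0, w) (1, 0) :=
    Filter.eventuallyEq_of_mem (hG.isMetricOn.isOpen.mem_nhds hx)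
      fun x hx => hG.isMetricOn.ricci_symm hx _ _
  rw [← fderiv_apply_apply hd, ← fderiv_apply_apply hd, h1.fderiv_eq,
    hG.isMetricOn.ricci_symm hx _ (0, w), hG.isMetricOn.ricci_symm hx (1, 0)]
  ring

/-- If the Ricci tensor of `-dt² + a(t)² h` is Killing and `a` is not constant, then the metric is
Einstein. -/
theorem exists_ricci_eq_mul (hJ : J.OrdConnected) (ha : ∃ s ∈ J, ∃ t ∈ J, a s ≠ a t)
    (hV : 0 < Module.finrank ℝ V)
    (hK : ∀ x ∈ J ×ˢ U, ∀ u v w, covDerivRicci G x u v w + covDerivRicci G x v w u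
      + covDerivRicci G x w u v = 0) :
    ∃ κ : ℝ, ∀ x ∈ J ×ˢ U, ∀ v w, ricci G x v w = κ * G x v w := by
  rcases U.eq_empty_or_nonempty with rfl | ⟨y₀, hy₀⟩
  · exact ⟨0, by simp⟩
  have hconst : ∀ f : ℝ → ℝ, (∀ t ∈ J, HasDerivAt f 0 t) → ∃ c, ∀ t ∈ J, f t = c := fun f hf =>
    hG.isOpen.exists_is_const_of_deriv_eq_zero hJ.isPreconnected
      (fun t ht => (hf t ht).differentiableAt.differentiableWithinAt) fun t ht => (hf t ht).deriv
  have hV' : (Module.finrank ℝ V : ℝ) ≠ 0 := by exact_mod_cast hV.ne'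
  -- On three copies of `∂_t` the cyclic sum is three times one term, so `a''/a` has zero
  -- derivative.
  obtain ⟨c, hc⟩ := hconst (fun s => deriv (deriv a) s / a s) fun t ht => by
    have h1 := hK (t, y₀) ⟨ht, hy₀⟩ (1, 0) (1, 0) (1, 0)
    rw [hG.covDerivRicci_time_time_time ht hy₀] at h1
    have h2 : deriv (fun s => deriv (deriv a) s / a s) t = 0 := by
      have : (Module.finrank ℝ V : ℝ) * deriv (fun s => deriv (deriv a) s / a s) t = 0 := by
        linarith
      simpa [hV'] using this
    rw [← h2]
    exact ((hG.hasDerivAt_deriv_deriv ht).div (hG.hasDerivAt ht)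
      (hG.ne_zero t ht)).differentiableAt.hasDerivAt
  have hc2 : ∀ t ∈ J, deriv (deriv a) t = c * a t := fun t ht => by
    rw [← hc t ht, div_mul_cancel₀ _ (hG.ne_zero t ht)]
  have hc3 : ∀ t ∈ J, deriv (deriv (deriv a)) t = c * deriv a t := fun t ht => by
    have : deriv (deriv a) =ᶠ[nhds t] fun s => c * a s :=
      Filter.eventuallyEq_of_mem (hG.isOpen.mem_nhds ht) hc2
    rw [this.deriv_eq]
    exact ((hG.hasDerivAt ht).const_mul c).deriv
  -- The energy integral of `a'' = c a`.
  obtain ⟨q, hq⟩ := hconst (fun s => deriv a s ^ 2 - c * a s ^ 2) fun t ht => by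
    refine (((hG.hasDerivAt_deriv ht).pow 2).sub
      (((hG.hasDerivAt ht).pow 2).const_mul c)).congr_deriv ?_
    simp [hc2 t ht]
    ring
  obtain ⟨t₀, ht₀, h0⟩ : ∃ t ∈ J, deriv a t ≠ 0 := by
    by_contra! hcon
    obtain ⟨d, hd⟩ := hconst a fun t ht => hcon t ht ▸ hG.hasDerivAt ht
    obtain ⟨s, hs, t, ht, hst⟩ := ha
    exact hst ((hd s hs).trans (hd t ht).symm)
  -- With `a'' = c a` and `a''' = c a'`, the cyclic sum is a multiple of `a'(t₀) (Ric_h + (m - 1) q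
  -- h)`, and `a'(t₀)` cancels. As `q` is independent of `y`, neither Schur's lemma nor
  -- connectedness of `U` is required.
  have hfiber : ∀ y ∈ U, ∀ v w, ricci h y v w = -((Module.finrank ℝ V : ℝ) - 1) * q * h y v w := by
    intro y hy v w
    have h1 := hK (t₀, y) ⟨ht₀, hy⟩ (1, 0) (0, v) (0, w)
    have h2 := hG.ne_zero t₀ ht₀
    have h3 := hq t₀ ht₀
    rw [hG.covDerivRicci_time_space_space ht₀ hy, hG.covDerivRicci_space_space_time ht₀ hy,
      hG.covDerivRicci_space_time_space ht₀ hy, (hG.hasDerivAt_ricciCoeff ht₀).deriv,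
      hG.isMetricOn_fiber.ricci_symm hy w v, hG.isMetricOn_fiber.symm y hy w v] at h1
    simp only [ricciCoeff, hc2 t₀ ht₀, hc3 t₀ ht₀] at h1
    field_simp at h1
    rw [← h3]
    have h4 : deriv a t₀ * (ricci h y v w
        - -((Module.finrank ℝ V : ℝ) - 1) * (deriv a t₀ ^ 2 - c * a t₀ ^ 2) * h y v w) = 0 := by
      linear_combination (-1 / 4 : ℝ) * h1
    exact sub_eq_zero.1 ((mul_eq_zero.1 h4).resolve_left h0)
  -- The fibre coefficient is `c a² + (m - 1) (a'² - q) = m c a²`, which matches the coefficient `-m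
  -- c` of `dt²`.
  refine ⟨Module.finrank ℝ V * c, fun x hx v w => ?_⟩
  have hx1 : x.1 ∈ J := hx.1
  have hx2 : x.2 ∈ U := hx.2
  have h3 := hq x.1 hx1
  have h4 := hG.ne_zero x.1 hx1
  rw [← Prod.mk.eta (p := x), hG.ricci_eq hx1 hx2, hG.apply_eq _ hx1 _ hx2, hfiber _ hx2, ← h3,
    ricciCoeff, hc2 _ hx1]
  field_simp
  ring

end IsGRWOn
end WarpedProduct
end SemiRiem

namespace SemiRiem

/-! ### Riemannian metrics read in charts. -/

section Charts

variable {E : Type*} [NormedAddCommGroup E] [NormedSpace ℝ E]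
  {H : Type*} [TopologicalSpace H] {I : ModelWithCorners ℝ E H} [I.Boundaryless]
  {M : Type*} [TopologicalSpace M] [ChartedSpace H M] [IsManifold I ∞ M]
  {e : OpenPartialHomeomorph M H} {x : E}

omit [I.Boundaryless] in
theorem contMDiffOn_extend_symm_target (he : e ∈ atlas H M) :
    ContMDiffOn 𝓘(ℝ, E) I ∞ (e.extend I).symm (e.extend I).target :=
  (contMDiffOn_extend_symm (IsManifold.subset_maximalAtlas he)).mono fun x hx => by
    rw [OpenPartialHomeomorph.extend_target] at hx
    exact ⟨I.symm x, hx.1, I.right_inv hx.2⟩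

theorem mdifferentiableAt_extend_symm (he : e ∈ atlas H M) (hx : x ∈ (e.extend I).target) :
    MDifferentiableAt 𝓘(ℝ, E) I (e.extend I).symm x :=
  ((contMDiffOn_extend_symm_target he).contMDiffAt
    (e.isOpen_extend_target.mem_nhds hx)).mdifferentiableAt (by simp)

theorem contMDiffOn_mfderiv_extend_symm (he : e ∈ atlas H M) (v : E) :
    ContMDiffOn 𝓘(ℝ, E) I.tangent ∞
      (fun x => (⟨(e.extend I).symm x, mfderiv 𝓘(ℝ, E) I (e.extend I).symm x v⟩ :
        TangentBundle I M)) (e.extend I).target := by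
  have ho : IsOpen (e.extend I).target := e.isOpen_extend_target
  have : IsManifold I 1 M := IsManifold.of_le (n := ∞) (by simp)
  have h2 := (contMDiffOn_extend_symm_target (I := I) he).contMDiffOn_tangentMapWithin
    (m := ∞) (by simp) ho.uniqueMDiffOn
  have h3 : ContMDiff 𝓘(ℝ, E) 𝓘(ℝ, E).tangent ∞
      (fun x => (⟨x, v⟩ : TangentBundle 𝓘(ℝ, E) E)) :=
    contMDiff_vectorSpace_iff_contDiff.2 contDiff_const
  have h4 := h2.comp h3.contMDiffOn (s := (e.extend I).target) (fun x hx => hx)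
  refine h4.congr fun x hx => ?_
  simp only [Function.comp_apply, tangentMapWithin, mfderivWithin_of_isOpen ho hx]

theorem mfderiv_extend_symm_injective (he : e ∈ atlas H M) (hx : x ∈ (e.extend I).target) :
    Function.Injective (mfderiv 𝓘(ℝ, E) I (e.extend I).symm x) := by
  have h1 : MDifferentiableAt I 𝓘(ℝ, E) (e.extend I) ((e.extend I).symm x) :=
    ((e.contMDiffOn_extend (n := ∞) (IsManifold.subset_maximalAtlas he)).contMDiffAt
      (e.open_source.mem_nhds (by
        rw [← e.extend_source (I := I)]; exact (e.extend I).map_target hx))).mdifferentiableAt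
      (by simp)
  have h2 := mfderiv_comp x h1 (mdifferentiableAt_extend_symm he hx)
  have h3 : (e.extend I) ∘ (e.extend I).symm =ᶠ[nhds x] id :=
    Filter.eventuallyEq_of_mem (e.isOpen_extend_target.mem_nhds hx)
      fun y hy => (e.extend I).right_inv hy
  rw [h3.mfderiv_eq, mfderiv_id] at h2
  refine Function.LeftInverse.injective
    (g := mfderiv I 𝓘(ℝ, E) (e.extend I) ((e.extend I).symm x)) fun v => ?_
  exact (congrArg (fun L => L v) h2).symm

/-- Smoothness comes from pairing the smooth bundle metric with the coordinate fields; nondegeneracy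
from positivity and the injectivity of the derivative of the inverse chart. -/
theorem isMetricOn_inChart [FiniteDimensional ℝ E]
    (g : Bundle.ContMDiffRiemannianMetric I ∞ E (fun p : M => TangentSpace I p))
    (he : e ∈ atlas H M) :
    IsMetricOn (inChart (I := I) g.inner e) (e.extend I).target where
  isOpen := e.isOpen_extend_target
  contDiffOn := by
    refine contDiffOn_clm_apply.2 fun v => contDiffOn_clm_apply.2 fun w => ?_
    rw [← contMDiffOn_iff_contDiffOn]
    intro x hx
    have h1 := contMDiffOn_mfderiv_extend_symm (I := I) he v x hx
    have h2 := contMDiffOn_mfderiv_extend_symm (I := I) he w x hx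
    have hb := contMDiffOn_extend_symm_target (I := I) he x hx
    have h3 : ContMDiffWithinAt 𝓘(ℝ, E) (I.prod 𝓘(ℝ, ℝ)) ∞
        (fun x => Bundle.TotalSpace.mk' ℝ (E := Bundle.Trivial M ℝ) ((e.extend I).symm x)
          (g.inner ((e.extend I).symm x) (mfderiv 𝓘(ℝ, E) I (e.extend I).symm x v)
            (mfderiv 𝓘(ℝ, E) I (e.extend I).symm x w))) (e.extend I).target x := by
      apply ContMDiffWithinAt.clm_bundle_apply₂ (F₁ := E) (F₂ := E)
      · exact ContMDiffAt.comp_contMDiffWithinAt x g.contMDiff.contMDiffAt hb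
      · exact h1
      · exact h2
    exact (Bundle.contMDiffWithinAt_totalSpace.1 h3).2
  symm x hx v w := g.symm _ _ _
  isInvertible x hx := by
    refine isInvertible_of_nondegenerate fun v hv => ?_
    by_contra hne
    have h1 : mfderiv 𝓘(ℝ, E) I (e.extend I).symm x v ≠ 0 := fun h =>
      hne (mfderiv_extend_symm_injective he hx (h.trans (map_zero _).symm))
    exact (g.pos _ _ h1).ne' (hv v)

end Charts

/-! ### The space-time metric in product charts. -/

section GRW

variable {m : ℕ} {M : Type*} [TopologicalSpace M] [ChartedSpace (EuclideanSpace ℝ (Fin m)) M]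
  [IsManifold (𝓡 m) ∞ M]

/-- The charts of an open subset of `ℝ` are restrictions of the identity, so the first coordinate is
literally `t` and `a` needs no reparametrization. -/
theorem opens_atlas_extend {J : TopologicalSpace.Opens ℝ} {e : OpenPartialHomeomorph J ℝ}
    (he : e ∈ atlas ℝ J) : (e.extend 𝓘(ℝ, ℝ)).target = J ∧
      ∀ t ∈ J, ((e.extend 𝓘(ℝ, ℝ)).symm t : ℝ) = t := by
  obtain ⟨x, rfl⟩ : ∃ x : J, e = (OpenPartialHomeomorph.refl ℝ).subtypeRestr ⟨x⟩ := by
    obtain ⟨_, ⟨x, rfl⟩, hx⟩ := he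
    exact ⟨x, hx⟩
  have htarget : ((OpenPartialHomeomorph.refl ℝ).subtypeRestr (⟨x⟩ : Nonempty J)).target = J := by
    ext t
    simp [OpenPartialHomeomorph.subtypeRestr_def]
  refine ⟨by rw [← htarget]; simp [OpenPartialHomeomorph.extend], fun t ht => ?_⟩
  exact OpenPartialHomeomorph.subtypeRestr_symm_apply (OpenPartialHomeomorph.refl ℝ)
    (⟨x⟩ : Nonempty J) (htarget ▸ ht)

omit [ChartedSpace (EuclideanSpace ℝ (Fin m)) M] [IsManifold (𝓡 m) ∞ M] in
theorem prod_extend_target {J : TopologicalSpace.Opens ℝ} {e₁ : OpenPartialHomeomorph J ℝ}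
    (he₁ : e₁ ∈ atlas ℝ J) (e₂ : OpenPartialHomeomorph M (EuclideanSpace ℝ (Fin m))) :
    ((e₁.prod e₂).extend (𝓘(ℝ, ℝ).prod (𝓡 m))).target
      = (J : Set ℝ) ×ˢ (e₂.extend (𝓡 m)).target := by
  rw [OpenPartialHomeomorph.extend_prod, PartialEquiv.prod_target, (opens_atlas_extend he₁).1]

/-- By the chain rule, `dt` and `dπ` composed with the derivative of the inverse chart are
derivatives of the composite maps: the first projection, and the inverse chart of `M` after the
second projection. -/
theorem isGRWOn_inChart (J : TopologicalSpace.Opens ℝ) (a : ℝ → ℝ)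
    (ha_smooth : ContDiffOn ℝ ∞ a J) (ha_pos : ∀ t ∈ J, 0 < a t)
    (gStar : Bundle.ContMDiffRiemannianMetric (𝓡 m) ∞ (EuclideanSpace ℝ (Fin m))
      (fun p : M => TangentSpace (𝓡 m) p))
    {e₁ : OpenPartialHomeomorph J ℝ} (he₁ : e₁ ∈ atlas ℝ J)
    {e₂ : OpenPartialHomeomorph M (EuclideanSpace ℝ (Fin m))}
    (he₂ : e₂ ∈ atlas (EuclideanSpace ℝ (Fin m)) M) :
    IsGRWOn a J (inChart (I := 𝓡 m) gStar.inner e₂) (e₂.extend (𝓡 m)).target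
      (inChart (grwMetric J a gStar) (e₁.prod e₂)) where
  isOpen := J.isOpen
  contDiffOn := ha_smooth
  ne_zero t ht := (ha_pos t ht).ne'
  isMetricOn_fiber := isMetricOn_inChart gStar he₂
  apply_eq t ht y hy v w := by
    have ht2 := (opens_atlas_extend he₁).2
    have htarget := prod_extend_target he₁ e₂
    have hx : (t, y) ∈ ((e₁.prod e₂).extend (𝓘(ℝ, ℝ).prod (𝓡 m))).target := htarget ▸ ⟨ht, hy⟩
    have he : e₁.prod e₂ ∈ atlas (ModelProd ℝ (EuclideanSpace ℝ (Fin m))) (J × M) :=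
      Set.mem_image2_of_mem he₁ he₂
    have : (𝓘(ℝ, ℝ).prod (𝓡 m)).Boundaryless :=
      ModelWithCorners.range_eq_univ_prod 𝓘(ℝ, ℝ) (𝓡 m)
    have hd := mdifferentiableAt_extend_symm (I := 𝓘(ℝ, ℝ).prod (𝓡 m)) he hx
    have hnhds := ((e₁.prod e₂).isOpen_extend_target (I := 𝓘(ℝ, ℝ).prod (𝓡 m))).mem_nhds hx
    have h1 : MDifferentiableAt (𝓘(ℝ, ℝ).prod (𝓡 m)) 𝓘(ℝ, ℝ) (fun r : J × M => (r.1 : ℝ))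
        (((e₁.prod e₂).extend (𝓘(ℝ, ℝ).prod (𝓡 m))).symm (t, y)) :=
      ((contMDiff_subtype_val (n := ∞)).comp contMDiff_fst).mdifferentiableAt (by simp)
    have h2 : MDifferentiableAt (𝓘(ℝ, ℝ).prod (𝓡 m)) (𝓡 m) (fun r : J × M => r.2)
        (((e₁.prod e₂).extend (𝓘(ℝ, ℝ).prod (𝓡 m))).symm (t, y)) := mdifferentiableAt_snd
    have h3 := mfderiv_comp (t, y) h1 hd
    have h4 := mfderiv_comp (t, y) h2 hd
    have h5 : (fun r : J × M => (r.1 : ℝ)) ∘ ((e₁.prod e₂).extend (𝓘(ℝ, ℝ).prod (𝓡 m))).symm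
        =ᶠ[nhds (t, y)] Prod.fst :=
      Filter.eventuallyEq_of_mem hnhds fun z hz => by
        rw [htarget] at hz
        exact ht2 z.1 hz.1
    have h6 : (fun r : J × M => r.2) ∘ ((e₁.prod e₂).extend (𝓘(ℝ, ℝ).prod (𝓡 m))).symm
        = (e₂.extend (𝓡 m)).symm ∘ Prod.snd := rfl
    have h7 := mfderiv_comp (t, y)
      (mdifferentiableAt_extend_symm (I := 𝓡 m) he₂ (x := (t, y).2) hy)
      (I := 𝓘(ℝ, ℝ × EuclideanSpace ℝ (Fin m))) (f := Prod.snd)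
      differentiableAt_snd.mdifferentiableAt
    have h8 : ∀ u : ℝ × EuclideanSpace ℝ (Fin m),
        mfderiv 𝓘(ℝ, ℝ × EuclideanSpace ℝ (Fin m)) 𝓘(ℝ, ℝ) Prod.fst (t, y) u = u.1 := fun u => by
      rw [mfderiv_eq_fderiv, fderiv_fst]; rfl
    have h9 : ∀ u : ℝ × EuclideanSpace ℝ (Fin m),
        mfderiv 𝓘(ℝ, ℝ × EuclideanSpace ℝ (Fin m)) 𝓘(ℝ, EuclideanSpace ℝ (Fin m))
          Prod.snd (t, y) u = u.2 := fun u => by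
      rw [mfderiv_eq_fderiv, fderiv_snd]; rfl
    rw [h5.mfderiv_eq] at h3
    rw [h6, h7] at h4
    have h10 := fun u => (congrArg (fun L => L u) h3).symm.trans (h8 u)
    have h11 := fun u => (congrArg (fun L => L u) h4).symm.trans
      (congrArg (mfderiv 𝓘(ℝ, EuclideanSpace ℝ (Fin m)) (𝓡 m) (e₂.extend (𝓡 m)).symm y) (h9 u))
    refine (grwMetric_apply J a gStar _ _ _).trans ?_
    exact congrArg₂ (· - ·)
      (congrArg₂ (· * ·) (congrArg (fun s => a s ^ 2) (ht2 t ht))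
        (congrArg₂ (fun X Y => gStar.inner ((e₂.extend (𝓡 m)).symm y) X Y) (h11 v) (h11 w)))
      (congrArg₂ (· * ·) (h10 v) (h10 w))

end GRW
end SemiRiem

end

theorem mainTheorem6 {m : ℕ} (hm : 3 < m + 1)
    {M : Type*} [TopologicalSpace M] [ChartedSpace (EuclideanSpace ℝ (Fin m)) M]
    [IsManifold (𝓡 m) ∞ M]
    (gStar : Bundle.ContMDiffRiemannianMetric (𝓡 m) ∞ (EuclideanSpace ℝ (Fin m))
      (fun p : M => TangentSpace (𝓡 m) p))
    (J : TopologicalSpace.Opens ℝ) (hJ : (J : Set ℝ).OrdConnected)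
    (a : ℝ → ℝ) (ha_smooth : ContDiffOn ℝ ∞ a J) (ha_pos : ∀ t ∈ J, 0 < a t)
    (ha_nonconst : ∃ s ∈ J, ∃ t ∈ J, a s ≠ a t) :
    (SemiRiem.RicciIsKilling (SemiRiem.grwMetric J a gStar) →
      SemiRiem.RicciIsParallel (SemiRiem.grwMetric J a gStar) ∧
        SemiRiem.IsEinstein (SemiRiem.grwMetric J a gStar)) ∧
    (SemiRiem.RicciIsKilling (SemiRiem.grwMetric J a gStar) ↔
      SemiRiem.RicciIsParallel (SemiRiem.grwMetric J a gStar)) := by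
  have hKP : SemiRiem.RicciIsKilling (SemiRiem.grwMetric J a gStar) →
      SemiRiem.RicciIsParallel (SemiRiem.grwMetric J a gStar) ∧
        SemiRiem.IsEinstein (SemiRiem.grwMetric J a gStar) := by
    intro hK
    -- Here `κ` may depend on the chart: both conclusions are checked chart by chart, and the trace
    -- replaces `κ` by `R / n`.
    have key : ∀ e ∈ atlas (ModelProd ℝ (EuclideanSpace ℝ (Fin m))) (J × M),
        SemiRiem.IsMetricOn (SemiRiem.inChart (SemiRiem.grwMetric J a gStar) e)
          (e.extend (𝓘(ℝ, ℝ).prod (𝓡 m))).target ∧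
        ∃ κ : ℝ, ∀ x ∈ (e.extend (𝓘(ℝ, ℝ).prod (𝓡 m))).target, ∀ v w,
          SemiRiem.ricci (SemiRiem.inChart (SemiRiem.grwMetric J a gStar) e) x v w =
            κ * SemiRiem.inChart (SemiRiem.grwMetric J a gStar) e x v w := by
      intro e he
      have hKe := hK e he
      -- The atlas of `J × M` consists of products of charts, so every chart separates `t` from the
      -- fibre.
      obtain ⟨e₁, he₁, e₂, he₂, rfl⟩ := he
      have hG := SemiRiem.isGRWOn_inChart J a ha_smooth ha_pos gStar he₁ he₂
      rw [SemiRiem.prod_extend_target he₁ e₂] at hKe ⊢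
      refine ⟨hG.isMetricOn, hG.exists_ricci_eq_mul hJ ha_nonconst ?_ hKe⟩
      rw [finrank_euclideanSpace_fin]
      omega
    refine ⟨fun e he x hx u v w => ?_, fun e he x hx v w => ?_⟩
    · obtain ⟨hG, κ, hκ⟩ := key e he
      exact hG.covDerivRicci_eq_zero hκ hx u v w
    · obtain ⟨hG, κ, hκ⟩ := key e he
      have hn : (Module.finrank ℝ (ℝ × EuclideanSpace ℝ (Fin m)) : ℝ) ≠ 0 := by
        rw [Module.finrank_prod, Module.finrank_self]
        positivity
      rw [hκ x hx, hG.scalarCurvature_eq hx (hκ x hx), mul_div_cancel_right₀ _ hn]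
  refine ⟨hKP, fun hK => (hKP hK).1, fun hP e he x hx u v w => ?_⟩
  rw [hP e he x hx, hP e he x hx, hP e he x hx, add_zero, add_zero]
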